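/- Conventions. A simple polytope $P\subset\mathbb R^n$ is given by an irredundant system $\langle a_i,x\rangle+b_i\ge 0$, $i=1,\dots,m$, whose solution set is bounded and $n$-dimensional and such that exactly $n$ of its facets $F_i=\{x\in P:\langle a_i,x\rangle+b_i=0\}$ meet at each vertex. It is flag if any set of pairwise intersecting facets has a common point. Its moment-angle manifold is $\mathcal Z_P=\{(x,z)\in P\times\mathbb C^m:\ |z_i|^2=\langle a_i,x\rangle+b_i,\ i=1,\dots,m\}$. A face cut $\mathrm{fc}(P)\subset\mathbb R^{n+1}$ of $P$ is a polytope obtained from $P\times[0,1]$ by cutting off the codimension-two face $F_i\times\{1\}$ for some facet $F_i$ of $P$: one adds to the inequalities of $P\times[0,1]$ an affine inequality $h\ge0$, where $h<0$ at the vertices of $P\times[0,1]$ lying in $F_i\times\{1\}$ and $h>0$ at all its other vertices. Let $R$ be a commutative ring with unit and $k\ge2$. For $\alpha_i\in H^{n_i}(X;R)$, $1\le i\le k$, a defining system is a strictly upper triangular $(k+1)\times(k+1)$ matrix $C=(c_{ij})$ of homogeneous singular cochains of $X$, with $\deg c_{ij}=n_i+\dots+n_{j-1}-(j-i)+1$ for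 $i<j$, such that $c_{i,i+1}$ is a cocycle representing $\alpha_i$ and $dC-\bar C\cdot C=a(C)E_{1,k+1}$ for some cochain $a(C)$, where $\bar c=(-1)^{\deg c}c$. The $k$-fold Massey product $\langle\alpha_1,\dots,\alpha_k\rangle$ is the set of all classes $[a(C)]$; it is defined if this set is nonempty, and nontrivial if it is defined and does not contain $0$. **Corollary.** Let $F=F^r$ be an $r$-dimensional flag simple polytope, $r\ge1$, and suppose that there is a nontrivial $k$-fold Massey product of classes of degrees $n_1,\dots,n_k$ in $H^*(\mathcal Z_F;R)$. Then there is a sequence of polytopes $P^n$, $n\ge r$, with $P^r=F$ and such that $P^{n+1}$ is a face cut of $P^n$ for each $n\ge r$, that is, $P^n=\mathrm{fc}^{\,n-r}(F)$. Moreover, for every such sequence and every $n\ge r$, $P^n$ is an $n$-dimensional flag simple polytope and there is a nontrivial $k$-fold Massey product of classes of degrees $n_1,\dots,n_k$ in $H^*(\mathcal Z_{P^n};R)$. -/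

import Mathlib

open CategoryTheory Opposite
open scoped Simplicial

noncomputable section

/-! ## Simple polytopes given by systems of linear inequalities -/

/-- A finite system of affine inequalities `⟨a i, x⟩ + b i ≥ 0` in `ℝⁿ`. -/
structure HPolytope (n : ℕ) where
  /-- the set of indices of the inequalities -/
  ι : Type
  fin : Fintype ι
  a : ι → Fin n → ℝ
  b : ι → ℝ

attribute [instance] HPolytope.fin

namespace HPolytope

variable {n : ℕ}

/-- The value of the `i`-th affine function `⟨a i, x⟩ + b i`. -/
def ell (P : HPolytope n) (i : P.ι) (x : Fin n → ℝ) : ℝ := P.a i ⬝ᵥ x + P.b i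

/-- The set of solutions of the system of inequalities. -/
def carrier (P : HPolytope n) : Set (Fin n → ℝ) := {x | ∀ i, 0 ≤ P.ell i x}

/-- The intersection of `P` with the facets `F i = {x ∈ P | ⟨a i, x⟩ + b i = 0}`, `i ∈ S`. -/
def face (P : HPolytope n) (S : Set P.ι) : Set (Fin n → ℝ) :=
  {x | x ∈ P.carrier ∧ ∀ i ∈ S, P.ell i x = 0}

/-- The vertices of `P`, that is, the extreme points of the underlying convex set. -/
def vertices (P : HPolytope n) : Set (Fin n → ℝ) := P.carrier.extremePoints ℝ

/-- `P` is a simple convex `n`-dimensional polytope presented without redundant inequalities. -/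
structure IsSimple (P : HPolytope n) : Prop where
  bounded : Bornology.IsBounded P.carrier
  /-- `P` is `n`-dimensional -/
  full_dim : (interior P.carrier).Nonempty
  /-- no inequality can be removed without changing `P` -/
  irredundant : ∀ i, ∃ x, P.ell i x < 0 ∧ ∀ j, j ≠ i → 0 ≤ P.ell j x
  /-- exactly `n` facets meet at each vertex -/
  simple : ∀ x ∈ P.vertices, {i | P.ell i x = 0}.ncard = n

/-- A polytope is flag if every set of pairwise intersecting facets has a common point. -/
def IsFlag (P : HPolytope n) : Prop :=
  ∀ S : Set P.ι, (∀ i ∈ S, ∀ j ∈ S, (P.face {i, j}).Nonempty) → (P.face S).Nonempty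

/-- The product `P × I ⊂ ℝⁿ⁺¹` with the unit segment `I = [0, 1]`: the inequalities of `P` in the
first `n` coordinates, together with `t ≥ 0` (index `inr 0`) and `1 - t ≥ 0` (index `inr 1`) for
the last coordinate `t`. -/
def prodInterval (P : HPolytope n) : HPolytope (n + 1) where
  ι := P.ι ⊕ Fin 2
  fin := inferInstance
  a := Sum.elim (fun i => Fin.snoc (P.a i) 0) ![Fin.snoc 0 1, Fin.snoc 0 (-1)]
  b := Sum.elim P.b ![0, 1]

/-- The intersection of `P` with the additional half-space `⟨c, x⟩ + d ≥ 0` (index `none`). -/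
def cut (P : HPolytope n) (c : Fin n → ℝ) (d : ℝ) : HPolytope n where
  ι := Option P.ι
  fin := inferInstance
  a := fun o => o.elim c P.a
  b := fun o => o.elim d P.b

/-- The hyperplane `⟨c, x⟩ + d = 0` cuts off the face `P.face S`: the vertices of `P` in this face
lie strictly on its negative side, all other vertices of `P` strictly on its positive side. -/
def CutsOff (P : HPolytope n) (S : Set P.ι) (c : Fin n → ℝ) (d : ℝ) : Prop :=
  ∀ v ∈ P.vertices, (v ∈ P.face S → c ⬝ᵥ v + d < 0) ∧ (v ∉ P.face S → 0 < c ⬝ᵥ v + d)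

/-- `Q` is a face cut `fc(P)` of `P`: it is obtained from `P × I` by cutting off
the codimension-two face `F i × {1}` for some facet `F i` of `P`. -/
def IsFaceCut (P : HPolytope n) (Q : HPolytope (n + 1)) : Prop :=
  ∃ (i : P.ι) (c : Fin (n + 1) → ℝ) (d : ℝ),
    P.prodInterval.CutsOff {Sum.inl i, Sum.inr 1} c d ∧ Q = P.prodInterval.cut c d

/-- `P r, P (r + 1), …` is a sequence of iterated face cuts of `F`, that is,
`P n = fc^(n - r)(F)` for `n ≥ r` (for some choice of the facets and of the cutting hyperplanes).
The terms `P n` with `n < r` are irrelevant. -/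
def IsFaceCutSequence {r : ℕ} (F : HPolytope r) (P : ∀ n, HPolytope n) : Prop :=
  P r = F ∧ ∀ n, r ≤ n → IsFaceCut (P n) (P (n + 1))

/-- The moment-angle manifold of `P`: the pullback of `i_P : P → ℝ^m`, `x ↦ (⟨a i, x⟩ + b i)_i`
along `μ : ℂ^m → ℝ^m`, `z ↦ (|z i|²)_i`. -/
def momentAngle (P : HPolytope n) : Set ((Fin n → ℝ) × (P.ι → ℂ)) :=
  {p | p.1 ∈ P.carrier ∧ ∀ i, ‖p.2 i‖ ^ 2 = P.ell i p.1}

/-- The moment-angle manifold of `P` as a topological space. -/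
def Z (P : HPolytope n) : TopCat.{0} := TopCat.of P.momentAngle

end HPolytope

/-! ## Singular cochains and Massey products -/

section Massey

/-- Singular cochains of `X` with coefficients in `R`, written as the family of their homogeneous
components: `f m` is a function on the singular `m`-simplices of `X`. -/
abbrev SingCochain (R : Type*) (X : TopCat.{0}) : Type _ :=
  ∀ m : ℕ, ((TopCat.toSSet.obj X) _⦋m⦌ → R)

variable (R : Type*) [CommRing R] (X : TopCat.{0})

namespace SingCochain

/-- The coboundary `(d f)(σ) = ∑ i, (-1)^i f(∂ᵢ σ)`. -/
def d : SingCochain R X →ₗ[R] SingCochain R X where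
  toFun f
    | 0 => 0
    | m + 1 => fun s => ∑ i : Fin (m + 2), (-1) ^ (i : ℕ) * f m ((TopCat.toSSet.obj X).δ i s)
  map_add' f g := by
    funext m s
    cases m with
    | zero => simp
    | succ m => simp [mul_add, Finset.sum_add_distrib]
  map_smul' r f := by
    funext m s
    cases m with
    | zero => simp
    | succ m => simp [Finset.mul_sum, mul_left_comm]

variable {R X}

/-- The cup product: `(f ∪ g)(σ) = ∑ f(front p-face of σ) * g(back (m - p)-face of σ)`
for an `m`-simplex `σ`, the sum being over `0 ≤ p ≤ m`. -/
def cup (f g : SingCochain R X) : SingCochain R X := fun m s =>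
  ∑ p : Fin (m + 1),
    f p ((TopCat.toSSet.obj X).map (SimplexCategory.subinterval 0 p (by omega)).op s) *
      g (m - p) ((TopCat.toSSet.obj X).map
        (SimplexCategory.subinterval p (m - p) (by omega)).op s)

/-- `bar f = (-1)^(deg f) f`, extended additively to nonhomogeneous cochains. -/
def bar (f : SingCochain R X) : SingCochain R X := fun m s => (-1) ^ m * f m s

/-- `f` is homogeneous of degree `e` (only `0` is homogeneous of negative degree). -/
def IsHomogeneous (f : SingCochain R X) (e : ℤ) : Prop := ∀ m : ℕ, (m : ℤ) ≠ e → f m = 0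

end SingCochain

open SingCochain

/-- The singular cohomology of `X`: cocycles modulo coboundaries. -/
abbrev SingCohomology : Type _ :=
  LinearMap.ker (d R X) ⧸ (LinearMap.range (d R X)).submoduleOf (LinearMap.ker (d R X))

variable {R X}

/-- `f` is a cocycle whose cohomology class is `α`. -/
def Represents (f : SingCochain R X) (α : SingCohomology R X) : Prop :=
  ∃ z : LinearMap.ker (d R X), (z : SingCochain R X) = f ∧ Submodule.Quotient.mk z = α

variable {k : ℕ}

/-- The degree `n_i + … + n_{j-1} - (j - i) + 1` of the entry `c_{i,j}` of a defining system. -/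
def entryDegree (deg : Fin k → ℕ) (i j : Fin (k + 1)) : ℤ :=
  (∑ l : Fin k with i.val ≤ l.val ∧ l.val < j.val, (deg l : ℤ)) - ((j : ℤ) - (i : ℤ)) + 1

/-- `C` is a defining system for the classes `α 0, …, α (k - 1)` of degrees
`deg 0, …, deg (k - 1)`, and `a = a(C)` is the cocycle that it determines. -/
structure IsDefiningSystem (deg : Fin k → ℕ) (α : Fin k → SingCohomology R X)
    (C : Matrix (Fin (k + 1)) (Fin (k + 1)) (SingCochain R X)) (a : SingCochain R X) : Prop where
  zero : ∀ i j, j ≤ i → C i j = 0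
  homogeneous : ∀ i j, i < j → (C i j).IsHomogeneous (entryDegree deg i j)
  represents : ∀ i : Fin k, Represents (C i.castSucc i.succ) (α i)
  /-- `a · E_{1,k+1} = d C - bar C · C` -/
  eq : ∀ i j, (if i = 0 ∧ j = Fin.last k then a else 0) =
    d R X (C i j) - ∑ l, cup (bar (C i l)) (C l j)

/-- The Massey product `⟨α 0, …, α (k - 1)⟩`, as a set of cohomology classes
(it is nonempty if and only if the Massey product is defined). -/
def masseyProduct (deg : Fin k → ℕ) (α : Fin k → SingCohomology R X) :
    Set (SingCohomology R X) :=
  {β | ∃ C a, IsDefiningSystem deg α C a ∧ Represents a β}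

variable (R X) in
/-- There is a nontrivial `k`-fold Massey product `⟨α 0, …, α (k - 1)⟩`, `α i ∈ H^(deg i)(X; R)`,
that is, one which is defined and does not contain `0`. -/
def HasNontrivialMasseyProduct (deg : Fin k → ℕ) : Prop :=
  ∃ α : Fin k → SingCohomology R X,
    (masseyProduct deg α).Nonempty ∧ 0 ∉ masseyProduct deg α

end Massey

end

/-!
The map `π : P × I → P` and the facet `P × {0}`, which the cut does not meet, make the
moment-angle manifold of `P` a retract of that of `fc(P)`: the additional complex coordinates of a
point over `P × {0}` can be chosen to be nonnegative reals, continuously in the point. Massey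
products are natural, so if `X` is a retract of `Y`, then pulling back along the retraction and the
inclusion shows that a nontrivial Massey product of `X` gives one of `Y`. Both `P ↦ P × I` and the
cut at a codimension-two face preserve simplicity and flagness. For flagness of the cut, let `S` be
a set of pairwise intersecting facets containing the new one. The corresponding old facets do not
all contain the cut-off face, so their common face reaches the positive side of the cutting
hyperplane. By flagness of the uncut polytope it also meets the cut-off face, hence the hyperplane.
-/

noncomputable section

/-! ### Massey products and retracts -/

namespace SingCochain

variable {R : Type*} [CommRing R] {X Y W : TopCat.{0}}

/-- The pullback `f^#` of singular cochains along a continuous map `f`. -/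
def pullback (f : X ⟶ Y) : SingCochain R Y →ₗ[R] SingCochain R X where
  toFun c m s := c m ((TopCat.toSSet.map f).app _ s)
  map_add' _ _ := rfl
  map_smul' _ _ := rfl

lemma pullback_id (c : SingCochain R X) : pullback (𝟙 X) c = c := rfl

lemma pullback_comp (f : X ⟶ Y) (g : Y ⟶ W) (c : SingCochain R W) :
    pullback (f ≫ g) c = pullback f (pullback g c) := rfl

lemma pullback_d (f : X ⟶ Y) (c : SingCochain R Y) :
    pullback f (d R Y c) = d R X (pullback f c) := by
  funext m s
  cases m <;> rfl

lemma pullback_cup (f : X ⟶ Y) (c c' : SingCochain R Y) :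
    pullback f (cup c c') = cup (pullback f c) (pullback f c') := rfl

lemma pullback_bar (f : X ⟶ Y) (c : SingCochain R Y) :
    pullback f (bar c) = bar (pullback f c) := rfl

lemma IsHomogeneous.pullback {c : SingCochain R Y} {e : ℤ} (hc : c.IsHomogeneous e) (f : X ⟶ Y) :
    (pullback f c).IsHomogeneous e := fun m hm =>
  funext fun s => congrFun (hc m hm) ((TopCat.toSSet.map f).app _ s)

end SingCochain

section Massey

variable {R : Type*} [CommRing R] {X Y W : TopCat.{0}}

variable (R) in
/-- The homomorphism `f^*` induced in singular cohomology by a continuous map `f`. -/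
def SingCohomology.map (f : X ⟶ Y) : SingCohomology R Y →ₗ[R] SingCohomology R X :=
  Submodule.mapQ _ _
    ((SingCochain.pullback f).restrict fun c (hc : SingCochain.d R Y c = 0) =>
      show SingCochain.d R X _ = 0 by rw [← SingCochain.pullback_d, hc, map_zero]) <| by
    rintro _ ⟨b, hb⟩
    exact ⟨SingCochain.pullback f b,
      (SingCochain.pullback_d f b).symm.trans (congrArg (SingCochain.pullback f) hb)⟩

lemma SingCohomology.map_id (α : SingCohomology R X) : map R (𝟙 X) α = α := by
  obtain ⟨c, rfl⟩ := Submodule.Quotient.mk_surjective _ α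
  exact congrArg Submodule.Quotient.mk (Subtype.ext (SingCochain.pullback_id c.1))

lemma SingCohomology.map_comp (f : X ⟶ Y) (g : Y ⟶ W) (α : SingCohomology R W) :
    map R (f ≫ g) α = map R f (map R g α) := by
  obtain ⟨c, rfl⟩ := Submodule.Quotient.mk_surjective _ α
  exact congrArg Submodule.Quotient.mk (Subtype.ext (SingCochain.pullback_comp f g c.1))

lemma Represents.pullback {c : SingCochain R Y} {α : SingCohomology R Y} (h : Represents c α)
    (f : X ⟶ Y) : Represents (SingCochain.pullback f c) (SingCohomology.map R f α) := by
  obtain ⟨z, rfl, rfl⟩ := h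
  exact ⟨_, rfl, rfl⟩

variable {k : ℕ} {deg : Fin k → ℕ}

lemma IsDefiningSystem.pullback {α : Fin k → SingCohomology R Y}
    {C : Matrix (Fin (k + 1)) (Fin (k + 1)) (SingCochain R Y)} {a : SingCochain R Y}
    (h : IsDefiningSystem deg α C a) (f : X ⟶ Y) :
    IsDefiningSystem deg (fun i => SingCohomology.map R f (α i))
      (C.map (SingCochain.pullback f)) (SingCochain.pullback f a) where
  zero i j hij := by rw [Matrix.map_apply, h.zero i j hij, map_zero]
  homogeneous i j hij := (h.homogeneous i j hij).pullback f
  represents i := (h.represents i).pullback f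
  eq i j := by
    simpa only [Matrix.map_apply, apply_ite (SingCochain.pullback f), map_sub, map_sum, map_zero,
      SingCochain.pullback_d, SingCochain.pullback_cup, SingCochain.pullback_bar]
      using congrArg (SingCochain.pullback f) (h.eq i j)

lemma map_mem_masseyProduct {α : Fin k → SingCohomology R Y} {β : SingCohomology R Y}
    (h : β ∈ masseyProduct deg α) (f : X ⟶ Y) :
    SingCohomology.map R f β ∈ masseyProduct deg fun i => SingCohomology.map R f (α i) := by
  obtain ⟨C, a, hC, ha⟩ := h
  exact ⟨_, _, hC.pullback f, ha.pullback f⟩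

lemma HasNontrivialMasseyProduct.of_retract (h : Retract X Y)
    (hX : HasNontrivialMasseyProduct R X deg) : HasNontrivialMasseyProduct R Y deg := by
  obtain ⟨α, ⟨β, hβ⟩, h_zero⟩ := hX
  have map_i_map_r (γ : SingCohomology R X) :
      SingCohomology.map R h.i (SingCohomology.map R h.r γ) = γ := by
    rw [← SingCohomology.map_comp, h.retract, SingCohomology.map_id]
  refine ⟨fun i => SingCohomology.map R h.r (α i), ⟨_, map_mem_masseyProduct hβ h.r⟩, fun h0 => ?_⟩
  have := map_mem_masseyProduct h0 h.i
  simp only [map_zero, map_i_map_r] at this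
  exact h_zero this

end Massey

/-! ### Faces and vertices -/

section Affine

variable {E : Type*} [AddCommGroup E] [Module ℝ E]

lemma tendsto_lineMap_nhdsGT_zero [TopologicalSpace E] [IsTopologicalAddGroup E]
    [ContinuousSMul ℝ E] (x y : E) :
    Filter.Tendsto (AffineMap.lineMap x y : ℝ → E) (nhdsWithin 0 (Set.Ioi 0)) (nhds x) := by
  have h_tendsto := ((AffineMap.lineMap_continuous (p := x) (q := y)).tendsto (0 : ℝ)).mono_left
    (nhdsWithin_le_nhds (s := Set.Ioi 0))
  rwa [AffineMap.lineMap_apply_zero] at h_tendsto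

lemma exists_pos_apply_lineMap {Q : Type*} [AddTorsor E Q] (f : Q →ᵃ[ℝ] ℝ) {x : Q} (hx : 0 < f x)
    (y : Q) : ∃ t ∈ Set.Ioo (0 : ℝ) 1, 0 < f (AffineMap.lineMap x y t) := by
  simp only [AffineMap.apply_lineMap]
  exact (Filter.Eventually.and (Ioo_mem_nhdsGT one_pos)
    ((tendsto_lineMap_nhdsGT_zero (f x) (f y)).eventually_const_lt hx)).exists

lemma exists_affineMap_eq_zero {s : Set E} (hs : Convex ℝ s) (f : E →ᵃ[ℝ] ℝ) {x y : E}
    (hx : x ∈ s) (hy : y ∈ s) (hfx : f x ≤ 0) (hfy : 0 ≤ f y) : ∃ z ∈ s, f z = 0 :=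
  (hs.affine_image f).ordConnected.out ⟨x, hx, rfl⟩ ⟨y, hy, rfl⟩ ⟨hfx, hfy⟩

end Affine

lemma snoc_dotProduct {R : Type*} [NonUnitalNonAssocSemiring R] {n : ℕ} (a : Fin n → R) (b : R)
    (y : Fin (n + 1) → R) :
    (Fin.snoc a b : Fin (n + 1) → R) ⬝ᵥ y = a ⬝ᵥ Fin.init y + b * y (Fin.last n) := by
  simp [dotProduct, Fin.sum_univ_castSucc, Fin.init]

namespace HPolytope

variable {n : ℕ} {P : HPolytope n}

/-- The function `x ↦ ⟨c, x⟩ + d`, bundled as an affine map. -/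
def affineForm (c : Fin n → ℝ) (d : ℝ) : (Fin n → ℝ) →ᵃ[ℝ] ℝ :=
  (dotProductBilin ℝ ℝ c).toAffineMap + AffineMap.const ℝ (Fin n → ℝ) d

/-- The set of facets of `P` through `x`. For `x ∉ P` this is the set of facet hyperplanes
through `x`. -/
def activeSet (P : HPolytope n) (x : Fin n → ℝ) : Set P.ι := {i | P.ell i x = 0}

lemma ell_lineMap (i : P.ι) (x y : Fin n → ℝ) (t : ℝ) :
    P.ell i (AffineMap.lineMap x y t) = (1 - t) * P.ell i x + t * P.ell i y := by
  have : P.ell i = affineForm (P.a i) (P.b i) := rfl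
  rw [this, AffineMap.apply_lineMap, AffineMap.lineMap_apply_ring]

lemma continuous_ell (P : HPolytope n) (i : P.ι) : Continuous (P.ell i) := by
  unfold ell
  fun_prop

lemma carrier_eq_iInter (P : HPolytope n) : P.carrier = ⋂ i, P.ell i ⁻¹' Set.Ici 0 := by
  ext x
  simp [carrier]

lemma face_eq_inter (P : HPolytope n) (S : Set P.ι) :
    P.face S = P.carrier ∩ ⋂ i ∈ S, P.ell i ⁻¹' {0} := by
  ext x
  simp [face]

lemma face_subset_face {S T : Set P.ι} (h : S ⊆ T) : P.face T ⊆ P.face S :=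
  fun _ hx => ⟨hx.1, fun i hi => hx.2 i (h hi)⟩

lemma isClosed_face (P : HPolytope n) (S : Set P.ι) : IsClosed (P.face S) := by
  rw [face_eq_inter, carrier_eq_iInter]
  exact (isClosed_iInter fun i => isClosed_Ici.preimage (P.continuous_ell i)).inter
    (isClosed_biInter fun i _ => isClosed_singleton.preimage (P.continuous_ell i))

lemma isCompact_face (hP : Bornology.IsBounded P.carrier) (S : Set P.ι) :
    IsCompact (P.face S) :=
  Metric.isCompact_of_isClosed_isBounded (P.isClosed_face S) (hP.subset fun _ hx => hx.1)

lemma convex_face (P : HPolytope n) (S : Set P.ι) : Convex ℝ (P.face S) := by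
  rw [face_eq_inter, carrier_eq_iInter]
  exact (convex_iInter fun i => (convex_Ici 0).affine_preimage (affineForm (P.a i) (P.b i))).inter
    (convex_iInter₂ fun i _ => (convex_singleton 0).affine_preimage (affineForm (P.a i) (P.b i)))

lemma isExtreme_face (P : HPolytope n) (S : Set P.ι) : IsExtreme ℝ P.carrier (P.face S) := by
  refine ⟨fun _ hx => hx.1, fun y hy z hz x hx hxyz => ⟨hy, fun i hi => ?_⟩⟩
  obtain ⟨t, ⟨ht0, ht1⟩, rfl⟩ := (openSegment_eq_image_lineMap ℝ y z).subset hxyz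
  have h_sum := hx.2 i hi
  rw [ell_lineMap] at h_sum
  have hz_nonneg : 0 ≤ t * P.ell i z := mul_nonneg ht0.le (hz i)
  nlinarith [hy i]

lemma mem_face_activeSet {x : Fin n → ℝ} (hx : x ∈ P.carrier) : x ∈ P.face (P.activeSet x) :=
  ⟨hx, fun _ hi => hi⟩

lemma eventually_lineMap_mem_carrier {x y : Fin n → ℝ} (hx : x ∈ P.carrier)
    (hy : ∀ i ∈ P.activeSet x, 0 ≤ P.ell i y) :
    ∀ᶠ t in nhdsWithin (0 : ℝ) (Set.Ioi 0), AffineMap.lineMap x y t ∈ P.carrier := by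
  refine Filter.eventually_all.2 fun i => ?_
  rcases (hx i).eq_or_lt with h_active | h_pos
  · filter_upwards [self_mem_nhdsWithin] with t (ht : 0 < t)
    rw [ell_lineMap, ← h_active, mul_zero, zero_add]
    exact mul_nonneg ht.le (hy i h_active.symm)
  · have h_tendsto := ((P.continuous_ell i).tendsto x).comp (tendsto_lineMap_nhdsGT_zero x y)
    exact (h_tendsto.eventually_const_lt h_pos).mono fun _ => le_of_lt

lemma eq_of_activeSet_subset {x y : Fin n → ℝ} (hx : x ∈ P.vertices)
    (hxy : P.activeSet x ⊆ P.activeSet y) : y = x := by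
  -- The points at parameters `t` and `-t` on the line from `x` to `y` both lie in `P`.
  have h_neg (i) (hi : i ∈ P.activeSet x) : P.ell i (AffineMap.lineMap x y (-1 : ℝ)) = 0 := by
    rw [ell_lineMap, show P.ell i x = 0 from hi, show P.ell i y = 0 from hxy hi]
    ring
  obtain ⟨t, ⟨hy_mem, hneg_mem⟩, ht : 0 < t⟩ :=
    (((eventually_lineMap_mem_carrier hx.1 fun i hi => (hxy hi).ge).and
      (eventually_lineMap_mem_carrier hx.1 fun i hi => (h_neg i hi).ge)).and
        self_mem_nhdsWithin).exists
  have h_mid : x ∈ openSegment ℝ (AffineMap.lineMap x y t)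
      (AffineMap.lineMap x (AffineMap.lineMap x y (-1 : ℝ)) t) := by
    refine ⟨1 / 2, 1 / 2, by norm_num, by norm_num, by norm_num, ?_⟩
    simp only [AffineMap.lineMap_apply_module']
    module
  have h_eq := (mem_extremePoints_iff_left.1 hx).2 _ hy_mem _ hneg_mem h_mid
  exact ((AffineMap.lineMap_eq_left_iff.1 h_eq).resolve_right ht.ne').symm

lemma mem_vertices_iff {x : Fin n → ℝ} :
    x ∈ P.vertices ↔ x ∈ P.carrier ∧ ∀ y, P.activeSet x ⊆ P.activeSet y → y = x := by
  refine ⟨fun hx => ⟨hx.1, fun y hxy => eq_of_activeSet_subset hx hxy⟩, fun ⟨hx, h_eq⟩ => ?_⟩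
  refine mem_extremePoints_iff_left.2 ⟨hx, fun y hy z hz hxyz => h_eq y ?_⟩
  exact ((P.isExtreme_face _).left_mem_of_mem_openSegment hy hz (mem_face_activeSet hx) hxyz).2

lemma finite_vertices (P : HPolytope n) : P.vertices.Finite :=
  Set.Finite.of_injOn (f := P.activeSet) (Set.mapsTo_univ _ _)
    (fun _ _ _ hy h_eq => eq_of_activeSet_subset hy h_eq.ge) Set.finite_univ

lemma exists_vertex_mem_face_forall_le (hP : Bornology.IsBounded P.carrier) {S : Set P.ι}
    (hS : (P.face S).Nonempty) (c : Fin n → ℝ) :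
    ∃ v ∈ P.vertices, v ∈ P.face S ∧ ∀ x ∈ P.face S, c ⬝ᵥ x ≤ c ⬝ᵥ v := by
  let l : StrongDual ℝ (Fin n → ℝ) := (dotProductBilin ℝ ℝ c).toContinuousLinearMap
  have h_exposed : IsExposed ℝ (P.face S) (l.toExposed (P.face S)) :=
    ContinuousLinearMap.toExposed.isExposed
  obtain ⟨x, hx, hx_max⟩ := (isCompact_face hP S).exists_isMaxOn hS l.continuous.continuousOn
  obtain ⟨v, hv⟩ :=
    (h_exposed.isCompact (isCompact_face hP S)).extremePoints_nonempty ⟨x, hx, hx_max⟩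
  have h_extreme := (P.isExtreme_face S).trans h_exposed.isExtreme
  exact ⟨v, h_extreme.extremePoints_subset_extremePoints hv, hv.1.1, hv.1.2⟩

lemma exists_vertex_mem_face (hP : Bornology.IsBounded P.carrier) {S : Set P.ι}
    (hS : (P.face S).Nonempty) : ∃ v ∈ P.vertices, v ∈ P.face S :=
  let ⟨v, hv, hvS, _⟩ := exists_vertex_mem_face_forall_le hP hS 0
  ⟨v, hv, hvS⟩

lemma neg_on_face_of_vertices (hP : Bornology.IsBounded P.carrier) {S : Set P.ι} {c : Fin n → ℝ}
    {d : ℝ} (h : ∀ v ∈ P.vertices, v ∈ P.face S → c ⬝ᵥ v + d < 0) {x : Fin n → ℝ}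
    (hx : x ∈ P.face S) : c ⬝ᵥ x + d < 0 := by
  obtain ⟨v, hv, hvS, h_max⟩ := exists_vertex_mem_face_forall_le hP ⟨x, hx⟩ c
  linarith [h v hv hvS, h_max x hx]

lemma pos_on_face_of_vertices (hP : Bornology.IsBounded P.carrier) {S : Set P.ι} {c : Fin n → ℝ}
    {d : ℝ} (h : ∀ v ∈ P.vertices, v ∈ P.face S → 0 < c ⬝ᵥ v + d) {x : Fin n → ℝ}
    (hx : x ∈ P.face S) : 0 < c ⬝ᵥ x + d := by
  have neg_eq (y : Fin n → ℝ) : -c ⬝ᵥ y + -d = -(c ⬝ᵥ y + d) := by rw [neg_dotProduct, neg_add]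
  have h_neg := neg_on_face_of_vertices hP (c := -c) (d := -d) (S := S) (fun v hv hvS => by
    rw [neg_eq]
    exact neg_neg_of_pos (h v hv hvS)) hx
  rw [neg_eq] at h_neg
  exact neg_lt_zero.1 h_neg

/-- The pairing of a vector with the normals of the facets through `x`. -/
def activeNormals (P : HPolytope n) (x : Fin n → ℝ) : (Fin n → ℝ) →ₗ[ℝ] (P.activeSet x → ℝ) :=
  LinearMap.pi fun i => dotProductBilin ℝ ℝ (P.a i)

lemma ell_add_of_mem_activeSet {x : Fin n → ℝ} (i : P.activeSet x) (u : Fin n → ℝ) :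
    P.ell i (x + u) = P.activeNormals x u i := by
  have hi : P.a i ⬝ᵥ x + P.b i = 0 := i.2
  change P.a i ⬝ᵥ (x + u) + P.b i = P.a i ⬝ᵥ u
  rw [dotProduct_add]
  linarith

lemma activeNormals_injective {v : Fin n → ℝ} (hv : v ∈ P.vertices) :
    Function.Injective (P.activeNormals v) := by
  refine (injective_iff_map_eq_zero _).2 fun u hu => ?_
  refine add_eq_left.1 (eq_of_activeSet_subset hv fun i hi => ?_ : v + u = v)
  exact (ell_add_of_mem_activeSet ⟨i, hi⟩ u).trans (congrFun hu ⟨i, hi⟩)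

lemma finrank_activeSet (P : HPolytope n) (x : Fin n → ℝ) :
    Module.finrank ℝ (P.activeSet x → ℝ) = (P.activeSet x).ncard := by
  classical
  rw [Module.finrank_fintype_fun_eq_card, Set.ncard_eq_toFinset_card', Set.toFinset_card]

lemma le_ncard_activeSet {v : Fin n → ℝ} (hv : v ∈ P.vertices) : n ≤ (P.activeSet v).ncard := by
  have h_le := LinearMap.finrank_le_finrank_of_injective (activeNormals_injective hv)
  rwa [Module.finrank_fin_fun, finrank_activeSet] at h_le

lemma IsSimple.activeNormals_surjective (hP : P.IsSimple) {v : Fin n → ℝ} (hv : v ∈ P.vertices) :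
    Function.Surjective (P.activeNormals v) := by
  have h_finrank : Module.finrank ℝ (Fin n → ℝ) = Module.finrank ℝ (P.activeSet v → ℝ) := by
    rw [Module.finrank_fin_fun, finrank_activeSet]
    exact (hP.simple v hv).symm
  exact (LinearMap.injective_iff_surjective_of_finrank_eq_finrank h_finrank).1
    (activeNormals_injective hv)

lemma IsSimple.exists_ell_eq_one (hP : P.IsSimple) {v : Fin n → ℝ} (hv : v ∈ P.vertices)
    {i : P.ι} (hi : i ∈ P.activeSet v) :
    ∃ y, P.ell i y = 1 ∧ ∀ j ∈ P.activeSet v, j ≠ i → P.ell j y = 0 := by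
  classical
  obtain ⟨u, hu⟩ := hP.activeNormals_surjective hv (Pi.single ⟨i, hi⟩ 1)
  refine ⟨v + u, ?_, fun j hj hji => ?_⟩
  · rw [ell_add_of_mem_activeSet ⟨i, hi⟩ u, hu, Pi.single_eq_same]
  · rw [ell_add_of_mem_activeSet ⟨j, hj⟩ u, hu, Pi.single_eq_of_ne]
    exact fun h => hji (congrArg Subtype.val h)

/-- A vertex of `P.face S` that maximizes the distance to the facet `i` cannot lie on it, since one
could leave this facet within all other facets through the vertex. -/
lemma IsSimple.exists_vertex_mem_face_pos (hP : P.IsSimple) {S : Set P.ι}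
    (hS : (P.face S).Nonempty) {i : P.ι} (hi : i ∉ S) :
    ∃ v ∈ P.vertices, v ∈ P.face S ∧ 0 < P.ell i v := by
  obtain ⟨v, hv, hvS, h_max⟩ := exists_vertex_mem_face_forall_le hP.bounded hS (P.a i)
  refine ⟨v, hv, hvS, (hvS.1 i).lt_of_ne' fun hvi => ?_⟩
  obtain ⟨y, hyi, hy⟩ := hP.exists_ell_eq_one hv hvi
  have hy_nonneg (j) (hj : j ∈ P.activeSet v) : 0 ≤ P.ell j y := by
    by_cases hji : j = i
    · rw [hji, hyi]
      exact zero_le_one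
    · exact (hy j hj hji).ge
  obtain ⟨t, h_mem, ht : 0 < t⟩ :=
    ((eventually_lineMap_mem_carrier hv.1 hy_nonneg).and self_mem_nhdsWithin).exists
  have h_face : AffineMap.lineMap v y t ∈ P.face S := ⟨h_mem, fun j hj => by
    rw [ell_lineMap, hvS.2 j hj, hy j (hvS.2 j hj) (ne_of_mem_of_not_mem hj hi)]
    ring⟩
  have h_le : P.ell i (AffineMap.lineMap v y t) ≤ P.ell i v :=
    add_le_add_left (h_max _ h_face) (P.b i)
  rw [ell_lineMap, hvi, hyi] at h_le
  linarith

lemma IsSimple.ncard_activeSet_lt (hP : P.IsSimple) {x : Fin n → ℝ} (hx : x ∈ P.carrier)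
    (hxv : x ∉ P.vertices) : (P.activeSet x).ncard < n := by
  obtain ⟨v, hv, hvx⟩ := exists_vertex_mem_face hP.bounded ⟨x, mem_face_activeSet hx⟩
  have h_ssubset : P.activeSet x ⊂ P.activeSet v :=
    ⟨hvx.2, fun h => hxv (eq_of_activeSet_subset hv h ▸ hv)⟩
  exact (Set.ncard_lt_ncard h_ssubset).trans_eq (hP.simple v hv)

lemma interior_nonempty_of_forall_pos {x : Fin n → ℝ} (hx : ∀ i, 0 < P.ell i x) :
    (interior P.carrier).Nonempty := by
  have h_nhds : ∀ᶠ y in nhds x, ∀ i, 0 < P.ell i y := Filter.eventually_all.2 fun i =>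
    ((P.continuous_ell i).tendsto x).eventually_const_lt (hx i)
  exact ⟨x, mem_interior_iff_mem_nhds.2 (h_nhds.mono fun y hy i => (hy i).le)⟩

lemma IsSimple.exists_forall_pos (hP : P.IsSimple) : ∃ x, ∀ i, 0 < P.ell i x := by
  obtain ⟨x, hx⟩ := hP.full_dim
  refine ⟨x, fun i => (interior_subset hx i).lt_of_ne' fun hxi => ?_⟩
  obtain ⟨y, hyi, -⟩ := hP.irredundant i
  obtain ⟨t, h_mem, ht : 0 < t⟩ := (((tendsto_lineMap_nhdsGT_zero x y).eventually
    (mem_interior_iff_mem_nhds.1 hx)).and self_mem_nhdsWithin).exists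
  have h_ell := h_mem i
  rw [ell_lineMap, hxi] at h_ell
  nlinarith

lemma IsSimple.face_singleton_nonempty (hP : P.IsSimple) (i : P.ι) : (P.face {i}).Nonempty := by
  obtain ⟨p, hp⟩ := hP.exists_forall_pos
  obtain ⟨y, hyi, hy⟩ := hP.irredundant i
  have h_convex : Convex ℝ (⋂ j ∈ {j | j ≠ i}, P.ell j ⁻¹' Set.Ici 0) :=
    convex_iInter₂ fun j _ => (convex_Ici 0).affine_preimage (affineForm (P.a j) (P.b j))
  obtain ⟨x, hx, hxi⟩ := exists_affineMap_eq_zero h_convex (affineForm (P.a i) (P.b i))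
    (Set.mem_iInter₂.2 hy) (Set.mem_iInter₂.2 fun j _ => (hp j).le) hyi.le (hp i).le
  refine ⟨x, fun j => ?_, by rintro _ rfl; exact hxi⟩
  by_cases hji : j = i
  · rw [hji]
    exact hxi.ge
  · exact Set.mem_iInter₂.1 hx j hji

lemma IsSimple.nonempty_index (hP : P.IsSimple) (hn : 0 < n) : Nonempty P.ι := by
  by_contra! h_empty
  have h_univ : P.carrier = Set.univ := Set.eq_univ_of_forall fun x i => isEmptyElim i
  have : Nonempty (Fin n) := ⟨⟨0, hn⟩⟩
  exact NormedSpace.unbounded_univ ℝ (Fin n → ℝ) (h_univ ▸ hP.bounded)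

lemma IsFlag.face_union_nonempty (hP : P.IsFlag) {S T : Set P.ι} (hS : (P.face S).Nonempty)
    (hT : (P.face T).Nonempty) (hST : ∀ i ∈ S, ∀ j ∈ T, (P.face {i, j}).Nonempty) :
    (P.face (S ∪ T)).Nonempty := by
  have pair {U : Set P.ι} (hU : (P.face U).Nonempty) (i) (hi : i ∈ U) (j) (hj : j ∈ U) :
      (P.face {i, j}).Nonempty :=
    hU.mono (face_subset_face (Set.pair_subset hi hj))
  refine hP _ ?_
  rintro i (hi | hi) j (hj | hj)
  · exact pair hS i hi j hj
  · exact hST i hi j hj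
  · exact Set.pair_comm j i ▸ hST j hj i hi
  · exact pair hT i hi j hj

/-! ### Cuts -/

section Cut

variable {c : Fin n → ℝ} {d : ℝ}

/-- The facet of `P.cut c d` contained in a given facet of `P`. -/
def oldFacet : P.ι ↪ (P.cut c d).ι := Function.Embedding.some

/-- The facet of `P.cut c d` in the cutting hyperplane. -/
def newFacet : (P.cut c d).ι := none

lemma oldFacet_ne_newFacet (i : P.ι) : (oldFacet i : (P.cut c d).ι) ≠ newFacet :=
  Option.some_ne_none i

lemma cut_ell_oldFacet (i : P.ι) : (P.cut c d).ell (oldFacet i) = P.ell i := rfl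

lemma cut_ell_newFacet (x : Fin n → ℝ) : (P.cut c d).ell newFacet x = c ⬝ᵥ x + d := rfl

lemma cut_forall {p : (P.cut c d).ι → Prop} : (∀ o, p o) ↔ p newFacet ∧ ∀ i, p (oldFacet i) :=
  Option.forall

lemma mem_cut_carrier {x : Fin n → ℝ} :
    x ∈ (P.cut c d).carrier ↔ x ∈ P.carrier ∧ 0 ≤ c ⬝ᵥ x + d := by
  simp only [carrier, Set.mem_ofPred_eq, cut_forall, cut_ell_oldFacet, cut_ell_newFacet]
  exact and_comm

lemma mem_cut_face {S : Set (P.cut c d).ι} {x : Fin n → ℝ} :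
    x ∈ (P.cut c d).face S ↔ x ∈ P.face (oldFacet ⁻¹' S) ∧ 0 ≤ c ⬝ᵥ x + d ∧
      (newFacet ∈ S → c ⬝ᵥ x + d = 0) := by
  simp only [face, mem_cut_carrier, Set.mem_ofPred_eq, cut_forall, cut_ell_oldFacet,
    cut_ell_newFacet, Set.mem_preimage]
  tauto

lemma activeSet_cut_of_eq_zero {x : Fin n → ℝ} (hx : c ⬝ᵥ x + d = 0) :
    (P.cut c d).activeSet x = insert newFacet (oldFacet '' P.activeSet x) := by
  refine Set.ext (cut_forall.2 ⟨?_, fun i => ?_⟩)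
  · simp [activeSet, cut_ell_newFacet, hx]
  · simp [activeSet, cut_ell_oldFacet, oldFacet_ne_newFacet]

lemma activeSet_cut_of_ne_zero {x : Fin n → ℝ} (hx : c ⬝ᵥ x + d ≠ 0) :
    (P.cut c d).activeSet x = oldFacet '' P.activeSet x := by
  refine Set.ext (cut_forall.2 ⟨?_, fun i => ?_⟩)
  · simp [activeSet, cut_ell_newFacet, hx, oldFacet_ne_newFacet]
  · simp [activeSet, cut_ell_oldFacet]

/-- A vertex of the cut polytope in the cutting hyperplane is not a vertex of `P`, so fewer than
`n` facets of `P` pass through it. Any other vertex is a vertex of `P`. -/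
lemma IsSimple.ncard_activeSet_cut (hP : P.IsSimple) (h_vert : ∀ v ∈ P.vertices, c ⬝ᵥ v + d ≠ 0)
    {w : Fin n → ℝ} (hw : w ∈ (P.cut c d).vertices) : ((P.cut c d).activeSet w).ncard = n := by
  have hwP := (mem_cut_carrier.1 hw.1).1
  by_cases h0 : c ⬝ᵥ w + d = 0
  · have h_lt := hP.ncard_activeSet_lt hwP fun hwv => h_vert w hwv h0
    have h_le := le_ncard_activeSet hw
    have h_notMem : (newFacet : (P.cut c d).ι) ∉ oldFacet '' P.activeSet w :=
      fun ⟨i, _, hi⟩ => oldFacet_ne_newFacet i hi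
    rw [activeSet_cut_of_eq_zero h0, Set.ncard_insert_of_notMem h_notMem,
      Set.ncard_image_of_injective _ oldFacet.injective] at h_le ⊢
    omega
  · have hwv : w ∈ P.vertices := by
      refine mem_vertices_iff.2 ⟨hwP, fun y hy => eq_of_activeSet_subset hw ?_⟩
      rw [activeSet_cut_of_ne_zero h0]
      exact Set.image_subset_iff.2 hy
    rw [activeSet_cut_of_ne_zero h0, Set.ncard_image_of_injective _ oldFacet.injective]
    exact hP.simple w hwv

lemma IsSimple.cut (hP : P.IsSimple) (h_vert : ∀ v ∈ P.vertices, c ⬝ᵥ v + d ≠ 0)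
    (h_neg : ∃ x ∈ P.carrier, c ⬝ᵥ x + d < 0) (h_pos : ∃ x ∈ P.carrier, 0 < c ⬝ᵥ x + d)
    (h_facet : ∀ i, ∃ x ∈ P.face {i}, 0 < c ⬝ᵥ x + d) : (P.cut c d).IsSimple where
  bounded := hP.bounded.subset fun x hx => (mem_cut_carrier.1 hx).1
  full_dim := by
    obtain ⟨x, hx, hx_pos⟩ := h_pos
    obtain ⟨p, hp⟩ := hP.exists_forall_pos
    obtain ⟨t, ⟨ht0, ht1⟩, h_line⟩ := exists_pos_apply_lineMap (affineForm c d) hx_pos p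
    refine interior_nonempty_of_forall_pos (cut_forall.2 ⟨h_line, fun i => ?_⟩)
    rw [cut_ell_oldFacet, ell_lineMap]
    exact add_pos_of_nonneg_of_pos (mul_nonneg (sub_nonneg.2 ht1.le) (hx i)) (mul_pos ht0 (hp i))
  irredundant := by
    refine cut_forall.2 ⟨?_, fun i => ?_⟩
    · obtain ⟨x, hx, hx_neg⟩ := h_neg
      exact ⟨x, hx_neg, cut_forall.2 ⟨fun h => absurd rfl h, fun i _ => hx i⟩⟩
    · obtain ⟨x, hx, hx_pos⟩ := h_facet i
      obtain ⟨y, hyi, hy⟩ := hP.irredundant i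
      obtain ⟨t, ⟨ht0, ht1⟩, h_line⟩ := exists_pos_apply_lineMap (affineForm c d) hx_pos y
      refine ⟨AffineMap.lineMap x y t, ?_, cut_forall.2 ⟨fun _ => h_line.le, fun j hj => ?_⟩⟩
      · rw [cut_ell_oldFacet, ell_lineMap, hx.2 i rfl, mul_zero, zero_add]
        exact mul_neg_of_pos_of_neg ht0 hyi
      · rw [cut_ell_oldFacet, ell_lineMap]
        exact add_nonneg (mul_nonneg (sub_nonneg.2 ht1.le) (hx.1 j))
          (mul_nonneg ht0.le (hy j fun h => hj (congrArg oldFacet h)))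
  simple _ hw := hP.ncard_activeSet_cut h_vert hw

variable {S T : Set P.ι}

lemma CutsOff.neg (h : P.CutsOff S c d) (hP : Bornology.IsBounded P.carrier) {x : Fin n → ℝ}
    (hx : x ∈ P.face S) : c ⬝ᵥ x + d < 0 :=
  neg_on_face_of_vertices hP (fun v hv hvS => (h v hv).1 hvS) hx

lemma CutsOff.face_union_nonempty (h : P.CutsOff S c d) (hP : Bornology.IsBounded P.carrier)
    {x : Fin n → ℝ} (hx : x ∈ P.face T) (hx_nonpos : c ⬝ᵥ x + d ≤ 0) :
    (P.face (S ∪ T)).Nonempty := by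
  by_contra h_empty
  refine hx_nonpos.not_gt (pos_on_face_of_vertices hP (fun v hv hvT => (h v hv).2 fun hvS => ?_) hx)
  exact h_empty ⟨v, hvS.1, fun i hi => hi.elim (hvS.2 i) (hvT.2 i)⟩

lemma CutsOff.exists_pos (h : P.CutsOff S c d) (hP : P.IsSimple) (hT : (P.face T).Nonempty)
    (hST : ¬ S ⊆ T) : ∃ x ∈ P.face T, 0 < c ⬝ᵥ x + d := by
  obtain ⟨i, hiS, hiT⟩ := Set.not_subset.1 hST
  obtain ⟨v, hv, hvT, hvi⟩ := hP.exists_vertex_mem_face_pos hT hiT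
  exact ⟨v, hvT, (h v hv).2 fun hvS => hvi.ne' (hvS.2 i hiS)⟩

lemma CutsOff.isSimple_cut (h : P.CutsOff S c d) (hP : P.IsSimple) (hS : S.Nontrivial)
    (hS_face : (P.face S).Nonempty) : (P.cut c d).IsSimple := by
  obtain ⟨x, hx⟩ := hS_face
  obtain ⟨y, hy, hy_pos⟩ := h.exists_pos hP ⟨x, face_subset_face (Set.empty_subset S) hx⟩
    fun h_empty => hS.nonempty.ne_empty (Set.subset_empty_iff.1 h_empty)
  refine hP.cut (fun v hv => ?_) ⟨x, hx.1, h.neg hP.bounded hx⟩ ⟨y, hy.1, hy_pos⟩ fun i =>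
    h.exists_pos hP (hP.face_singleton_nonempty i) hS.not_subset_singleton
  by_cases hvS : v ∈ P.face S
  · exact ((h v hv).1 hvS).ne
  · exact ((h v hv).2 hvS).ne'

lemma CutsOff.exists_neg (h : P.CutsOff S c d) (hP : Bornology.IsBounded P.carrier)
    (hF : P.IsFlag) (hS : (P.face S).Nonempty) (hT : (P.face T).Nonempty)
    (hT_nonpos : ∀ i ∈ T, ∃ x ∈ P.face {i}, c ⬝ᵥ x + d ≤ 0) : ∃ x ∈ P.face T, c ⬝ᵥ x + d < 0 := by
  have h_union : (P.face (S ∪ T)).Nonempty := hF.face_union_nonempty hS hT fun i hi j hj => by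
    obtain ⟨x, hx, hx_nonpos⟩ := hT_nonpos j hj
    exact (h.face_union_nonempty hP hx hx_nonpos).mono
      (face_subset_face (Set.pair_subset (Or.inl hi) (Or.inr rfl)))
  obtain ⟨x, hx⟩ := h_union
  exact ⟨x, face_subset_face Set.subset_union_right hx,
    h.neg hP (face_subset_face Set.subset_union_left hx)⟩

lemma CutsOff.isFlag_cut {i j : P.ι} (h : P.CutsOff {i, j} c d) (hP : P.IsSimple)
    (hF : P.IsFlag) : (P.cut c d).IsFlag := by
  intro S hS
  set T : Set P.ι := oldFacet ⁻¹' S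
  have old_pair {k l : P.ι} (hk : k ∈ T) (hl : l ∈ T) :
      ∃ x ∈ P.face {k, l}, 0 ≤ c ⬝ᵥ x + d := by
    obtain ⟨x, hx⟩ := hS _ hk _ hl
    obtain ⟨hxP, hx_nonneg, -⟩ := mem_cut_face.1 hx
    exact ⟨x, face_subset_face (by simp [Set.pair_subset_iff]) hxP, hx_nonneg⟩
  have hT : (P.face T).Nonempty := hF T fun k hk l hl =>
    let ⟨x, hx, _⟩ := old_pair hk hl
    ⟨x, hx⟩
  have hijT : ¬ {i, j} ⊆ T := fun h_sub => by
    obtain ⟨x, hx, hx_nonneg⟩ := old_pair (h_sub (Set.mem_insert i {j}))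
      (h_sub (Set.mem_insert_of_mem i rfl))
    exact hx_nonneg.not_gt (h.neg hP.bounded hx)
  obtain ⟨y, hyT, hy_pos⟩ := h.exists_pos hP hT hijT
  by_cases h_new : newFacet ∈ S
  · have new_pair {o} (ho : o ∈ S) : ∃ x ∈ P.face (oldFacet ⁻¹' {o}), c ⬝ᵥ x + d = 0 := by
      obtain ⟨x, hx⟩ := hS _ ho _ h_new
      obtain ⟨hxP, -, hx_zero⟩ := mem_cut_face.1 hx
      exact ⟨x, face_subset_face (Set.preimage_mono (by simp)) hxP, hx_zero (by simp)⟩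
    obtain ⟨p, hp, hp_zero⟩ := new_pair h_new
    have h_face : (P.face {i, j}).Nonempty := (h.face_union_nonempty hP.bounded hp hp_zero.le).mono
      (face_subset_face Set.subset_union_left)
    obtain ⟨x, hxT, hx_neg⟩ := h.exists_neg hP.bounded hF h_face hT fun k hk =>
      let ⟨x, hx, hx_zero⟩ := new_pair hk
      ⟨x, face_subset_face (by simp) hx, hx_zero.le⟩
    obtain ⟨z, hzT, hz⟩ := exists_affineMap_eq_zero (P.convex_face T) (affineForm c d)
      hxT hyT hx_neg.le hy_pos.le
    exact ⟨z, mem_cut_face.2 ⟨hzT, hz.ge, fun _ => hz⟩⟩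
  · exact ⟨y, mem_cut_face.2 ⟨hyT, hy_pos.le, fun h => absurd h h_new⟩⟩

/-- For small `ε > 0`, the hyperplane `∑ i ∈ S, ⟨a i, x⟩ + b i = ε` cuts off `P.face S`. -/
lemma exists_cutsOff (P : HPolytope n) (S : Set P.ι) : ∃ c d, P.CutsOff S c d := by
  classical
  let g (x : Fin n → ℝ) : ℝ := ∑ i ∈ S.toFinset, P.ell i x
  have hg_pos {v} (hv : v ∈ P.vertices) (hvS : v ∉ P.face S) : 0 < g v := by
    obtain ⟨i, hi, hvi⟩ : ∃ i ∈ S, P.ell i v ≠ 0 := by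
      by_contra! h
      exact hvS ⟨hv.1, h⟩
    exact Finset.sum_pos' (fun j _ => hv.1 j)
      ⟨i, Set.mem_toFinset.2 hi, (hv.1 i).lt_of_ne' hvi⟩
  have h_small : ∀ᶠ ε in nhdsWithin (0 : ℝ) (Set.Ioi 0),
      ∀ v ∈ P.vertices, v ∉ P.face S → ε < g v :=
    (Set.Finite.eventually_all P.finite_vertices).2 fun v hv => by
      by_cases hvS : v ∈ P.face S
      · exact .of_forall fun _ h => absurd hvS h
      · filter_upwards [Ioo_mem_nhdsGT (hg_pos hv hvS)] with ε hε _ using hε.2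
  obtain ⟨ε, h_lt, hε : 0 < ε⟩ := (h_small.and self_mem_nhdsWithin).exists
  have h_eq (x : Fin n → ℝ) :
      (∑ i ∈ S.toFinset, P.a i) ⬝ᵥ x + (∑ i ∈ S.toFinset, P.b i - ε) = g x - ε := by
    simp only [g, ell, sum_dotProduct, Finset.sum_add_distrib]
    ring
  refine ⟨∑ i ∈ S.toFinset, P.a i, ∑ i ∈ S.toFinset, P.b i - ε,
    fun v hv => ⟨fun hvS => ?_, fun hvS => ?_⟩⟩
  · rw [h_eq, show g v = 0 from Finset.sum_eq_zero fun i hi => hvS.2 i (Set.mem_toFinset.1 hi)]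
    linarith
  · rw [h_eq]
    exact sub_pos.2 (h_lt v hv hvS)

end Cut

/-! ### Products with an interval -/

/-- The facet `F i × I` of `P × I`. -/
def sideFacet : P.ι ↪ P.prodInterval.ι := Function.Embedding.inl

/-- The facet `P × {0}` of `P × I`. -/
def bottomFacet : P.prodInterval.ι := Sum.inr 0

/-- The facet `P × {1}` of `P × I`. -/
def topFacet : P.prodInterval.ι := Sum.inr 1

lemma prodInterval_forall {p : P.prodInterval.ι → Prop} :
    (∀ o, p o) ↔ (∀ i, p (sideFacet i)) ∧ p bottomFacet ∧ p topFacet :=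
  Sum.forall.trans (and_congr Iff.rfl Fin.forall_fin_two)

lemma sideFacet_ne_bottomFacet (i : P.ι) : sideFacet i ≠ bottomFacet := Sum.inl_ne_inr

lemma sideFacet_ne_topFacet (i : P.ι) : sideFacet i ≠ topFacet := Sum.inl_ne_inr

lemma bottomFacet_ne_topFacet : (bottomFacet : P.prodInterval.ι) ≠ topFacet :=
  fun h => zero_ne_one (Sum.inr_injective h)

lemma prodInterval_ell_sideFacet (i : P.ι) (y : Fin (n + 1) → ℝ) :
    P.prodInterval.ell (sideFacet i) y = P.ell i (Fin.init y) := by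
  change (Fin.snoc (P.a i) 0 : Fin (n + 1) → ℝ) ⬝ᵥ y + P.b i = _
  rw [snoc_dotProduct, zero_mul, add_zero, ell]

lemma prodInterval_ell_bottomFacet (y : Fin (n + 1) → ℝ) :
    P.prodInterval.ell bottomFacet y = y (Fin.last n) := by
  change (Fin.snoc 0 1 : Fin (n + 1) → ℝ) ⬝ᵥ y + 0 = _
  rw [snoc_dotProduct, zero_dotProduct, zero_add, one_mul, add_zero]

lemma prodInterval_ell_topFacet (y : Fin (n + 1) → ℝ) :
    P.prodInterval.ell topFacet y = 1 - y (Fin.last n) := by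
  change (Fin.snoc 0 (-1) : Fin (n + 1) → ℝ) ⬝ᵥ y + 1 = _
  rw [snoc_dotProduct, zero_dotProduct]
  ring

lemma mem_prodInterval_carrier {y : Fin (n + 1) → ℝ} :
    y ∈ P.prodInterval.carrier ↔ Fin.init y ∈ P.carrier ∧ y (Fin.last n) ∈ Set.Icc 0 1 := by
  simp only [carrier, Set.mem_ofPred_eq, prodInterval_forall, prodInterval_ell_sideFacet,
    prodInterval_ell_bottomFacet, prodInterval_ell_topFacet, Set.mem_Icc, sub_nonneg]

lemma mem_prodInterval_face {S : Set P.prodInterval.ι} {y : Fin (n + 1) → ℝ} :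
    y ∈ P.prodInterval.face S ↔ Fin.init y ∈ P.face (sideFacet ⁻¹' S) ∧
      y (Fin.last n) ∈ Set.Icc 0 1 ∧ (bottomFacet ∈ S → y (Fin.last n) = 0) ∧
      (topFacet ∈ S → y (Fin.last n) = 1) := by
  have top_iff : 1 - y (Fin.last n) = 0 ↔ y (Fin.last n) = 1 := by grind
  simp only [face, mem_prodInterval_carrier, Set.mem_ofPred_eq, prodInterval_forall,
    prodInterval_ell_sideFacet, prodInterval_ell_bottomFacet, prodInterval_ell_topFacet, top_iff,
    Set.mem_preimage]
  tauto

lemma isBounded_prodInterval (hP : Bornology.IsBounded P.carrier) :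
    Bornology.IsBounded P.prodInterval.carrier := by
  refine Bornology.forall_isBounded_image_eval_iff.1 (Fin.lastCases ?_ fun i => ?_)
  · refine (Metric.isBounded_Icc (0 : ℝ) 1).subset (Set.image_subset_iff.2 fun y hy => ?_)
    exact (mem_prodInterval_carrier.1 hy).2
  · refine (hP.image_eval i).subset (Set.image_subset_iff.2 fun y hy => ?_)
    exact ⟨Fin.init y, (mem_prodInterval_carrier.1 hy).1, rfl⟩

lemma activeSet_prodInterval_of_last_eq_zero {y : Fin (n + 1) → ℝ} (hy : y (Fin.last n) = 0) :
    P.prodInterval.activeSet y = insert bottomFacet (sideFacet '' P.activeSet (Fin.init y)) := by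
  refine Set.ext (prodInterval_forall.2 ⟨fun i => ?_, ?_, ?_⟩)
  · simp [activeSet, prodInterval_ell_sideFacet, sideFacet_ne_bottomFacet]
  · simp [activeSet, prodInterval_ell_bottomFacet, hy]
  · simp [activeSet, prodInterval_ell_topFacet, hy, bottomFacet_ne_topFacet.symm,
      sideFacet_ne_topFacet]

lemma activeSet_prodInterval_of_last_eq_one {y : Fin (n + 1) → ℝ} (hy : y (Fin.last n) = 1) :
    P.prodInterval.activeSet y = insert topFacet (sideFacet '' P.activeSet (Fin.init y)) := by
  refine Set.ext (prodInterval_forall.2 ⟨fun i => ?_, ?_, ?_⟩)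
  · simp [activeSet, prodInterval_ell_sideFacet, sideFacet_ne_topFacet]
  · simp [activeSet, prodInterval_ell_bottomFacet, hy, bottomFacet_ne_topFacet,
      sideFacet_ne_bottomFacet]
  · simp [activeSet, prodInterval_ell_topFacet, hy]

lemma init_mem_vertices {y : Fin (n + 1) → ℝ} (hy : y ∈ P.prodInterval.vertices) :
    Fin.init y ∈ P.vertices := by
  refine mem_vertices_iff.2 ⟨(mem_prodInterval_carrier.1 hy.1).1, fun x hx => ?_⟩
  have h_eq := eq_of_activeSet_subset hy (y := Fin.snoc x (y (Fin.last n))) <|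
    prodInterval_forall.2 ⟨fun i hi => ?_, ?_, ?_⟩
  · rw [← h_eq, Fin.init_snoc]
  · rw [activeSet, Set.mem_ofPred_eq, prodInterval_ell_sideFacet] at hi ⊢
    rw [Fin.init_snoc]
    exact hx hi
  · simp [activeSet, prodInterval_ell_bottomFacet]
  · simp [activeSet, prodInterval_ell_topFacet]

lemma last_eq_zero_or_one {y : Fin (n + 1) → ℝ} (hy : y ∈ P.prodInterval.vertices) :
    y (Fin.last n) = 0 ∨ y (Fin.last n) = 1 := by
  by_contra! h_ne
  have h_eq := eq_of_activeSet_subset hy (y := Fin.snoc (Fin.init y) (y (Fin.last n) + 1)) <|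
    prodInterval_forall.2 ⟨fun i hi => ?_, fun h => absurd ?_ h_ne.1, fun h => absurd ?_ h_ne.2⟩
  · simpa using congrFun h_eq (Fin.last n)
  · rw [activeSet, Set.mem_ofPred_eq, prodInterval_ell_sideFacet] at hi ⊢
    rwa [Fin.init_snoc]
  · rwa [activeSet, Set.mem_ofPred_eq, prodInterval_ell_bottomFacet] at h
  · rw [activeSet, Set.mem_ofPred_eq, prodInterval_ell_topFacet] at h
    linarith

lemma IsSimple.ncard_activeSet_prodInterval (hP : P.IsSimple) {y : Fin (n + 1) → ℝ}
    (hy : y ∈ P.prodInterval.vertices) : (P.prodInterval.activeSet y).ncard = n + 1 := by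
  have ncard_insert {o : P.prodInterval.ι} (ho : ∀ i, sideFacet i ≠ o) :
      (insert o (sideFacet '' P.activeSet (Fin.init y))).ncard = n + 1 := by
    have h_notMem : o ∉ sideFacet '' P.activeSet (Fin.init y) := fun ⟨i, _, hi⟩ => ho i hi
    rw [Set.ncard_insert_of_notMem h_notMem,
      Set.ncard_image_of_injective _ sideFacet.injective]
    exact congrArg (· + 1) (hP.simple _ (init_mem_vertices hy))
  rcases last_eq_zero_or_one hy with h0 | h1
  · rw [activeSet_prodInterval_of_last_eq_zero h0]
    exact ncard_insert sideFacet_ne_bottomFacet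
  · rw [activeSet_prodInterval_of_last_eq_one h1]
    exact ncard_insert sideFacet_ne_topFacet

lemma IsSimple.prodInterval (hP : P.IsSimple) : P.prodInterval.IsSimple where
  bounded := isBounded_prodInterval hP.bounded
  full_dim := by
    obtain ⟨p, hp⟩ := hP.exists_forall_pos
    refine interior_nonempty_of_forall_pos (x := Fin.snoc p (1 / 2)) ?_
    simp only [prodInterval_forall, prodInterval_ell_sideFacet, prodInterval_ell_bottomFacet,
      prodInterval_ell_topFacet, Fin.init_snoc, Fin.snoc_last]
    exact ⟨hp, by norm_num, by norm_num⟩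
  irredundant := by
    obtain ⟨p, hp⟩ := hP.exists_forall_pos
    simp only [prodInterval_forall, prodInterval_ell_sideFacet, prodInterval_ell_bottomFacet,
      prodInterval_ell_topFacet]
    refine ⟨fun i => ?_, ⟨Fin.snoc p (-1), ?_⟩, ⟨Fin.snoc p 2, ?_⟩⟩
    · obtain ⟨y, hyi, hy⟩ := hP.irredundant i
      refine ⟨Fin.snoc y 0, ?_⟩
      simp only [Fin.init_snoc, Fin.snoc_last]
      exact ⟨hyi, fun j hj => hy j fun h => hj (congrArg sideFacet h), by norm_num, by norm_num⟩
    · simp only [Fin.init_snoc, Fin.snoc_last]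
      exact ⟨by norm_num, fun j _ => (hp j).le, fun h => absurd rfl h, by norm_num⟩
    · simp only [Fin.init_snoc, Fin.snoc_last]
      exact ⟨by norm_num, fun j _ => (hp j).le, by norm_num, fun h => absurd rfl h⟩
  simple _ hy := hP.ncard_activeSet_prodInterval hy

lemma IsFlag.prodInterval (hF : P.IsFlag) : P.prodInterval.IsFlag := by
  classical
  intro S hS
  obtain ⟨x, hx⟩ : (P.face (sideFacet ⁻¹' S)).Nonempty := hF _ fun i hi j hj => by
    obtain ⟨y, hy⟩ := hS _ hi _ hj
    exact ⟨Fin.init y, face_subset_face (by simp [Set.pair_subset_iff])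
      (mem_prodInterval_face.1 hy).1⟩
  have h_disjoint (h_bot : bottomFacet ∈ S) (h_top : topFacet ∈ S) : False := by
    obtain ⟨y, hy⟩ := hS _ h_bot _ h_top
    obtain ⟨-, -, h0, h1⟩ := mem_prodInterval_face.1 hy
    exact zero_ne_one ((h0 (by simp)).symm.trans (h1 (by simp)))
  refine ⟨Fin.snoc x (if topFacet ∈ S then 1 else 0), mem_prodInterval_face.2 ?_⟩
  rw [Fin.init_snoc, Fin.snoc_last]
  refine ⟨hx, ?_, fun h_bot => if_neg (h_disjoint h_bot), fun h_top => if_pos h_top⟩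
  split_ifs <;> simp

/-! ### Face cuts -/

section Retract

variable {m : ℕ} {Q : HPolytope m} (e : P.ι ↪ Q.ι)

/-- Extends a family `z` of complex coordinates for some of the facets of `Q` to all facets, the
new coordinates being nonnegative reals such that `(y, z)` becomes a point of `Z_Q`. -/
def extendCoords (p : (Fin m → ℝ) × (P.ι → ℂ)) : Q.ι → ℂ :=
  Function.extend e p.2 fun o => (√(Q.ell o p.1) : ℂ)

lemma extendCoords_apply (p : (Fin m → ℝ) × (P.ι → ℂ)) (i : P.ι) :
    extendCoords e p (e i) = p.2 i :=
  e.injective.extend_apply _ _ i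

lemma extendCoords_apply_of_not_exists {o : Q.ι} (ho : ¬∃ i, e i = o)
    (p : (Fin m → ℝ) × (P.ι → ℂ)) : extendCoords e p o = √(Q.ell o p.1) :=
  Function.extend_apply' _ _ o ho

lemma continuous_extendCoords : Continuous (extendCoords e) := by
  refine continuous_pi fun o => ?_
  by_cases ho : ∃ i, e i = o
  · obtain ⟨i, rfl⟩ := ho
    simp only [extendCoords_apply]
    fun_prop
  · simp only [extendCoords_apply_of_not_exists e ho]
    exact Complex.continuous_ofReal.comp ((Q.continuous_ell o).comp continuous_fst).sqrt

lemma extendCoords_mem_momentAngle {y : Fin m → ℝ} {z : P.ι → ℂ} (hy : y ∈ Q.carrier)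
    (hz : ∀ i, ‖z i‖ ^ 2 = Q.ell (e i) y) : (y, extendCoords e (y, z)) ∈ Q.momentAngle := by
  refine ⟨hy, fun o => ?_⟩
  dsimp only
  by_cases ho : ∃ i, e i = o
  · obtain ⟨i, rfl⟩ := ho
    rw [extendCoords_apply, hz]
  · rw [extendCoords_apply_of_not_exists e ho, Complex.norm_real, Real.norm_eq_abs, sq_abs,
      Real.sq_sqrt (hy o)]

/-- If `s : P → Q` is a section of a map `π` that pulls every facet function of `P` back to a facet
function of `Q`, then `Z_P` is a retract of `Z_Q`. -/
def momentAngleRetract {π : (Fin m → ℝ) → (Fin n → ℝ)} (hπ : Continuous π)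
    {s : (Fin n → ℝ) → (Fin m → ℝ)} (hs : Continuous s) (h_section : Function.LeftInverse π s)
    (h_ell : ∀ i y, Q.ell (e i) y = P.ell i (π y)) (h_maps : Set.MapsTo s P.carrier Q.carrier) :
    Retract P.Z Q.Z where
  i := TopCat.ofHom
    { toFun p := ⟨(s p.1.1, extendCoords e (s p.1.1, p.1.2)),
        extendCoords_mem_momentAngle e (h_maps p.2.1) fun i => by
          rw [h_ell, h_section, p.2.2]⟩
      continuous_toFun := by
        have h_base : Continuous fun p : P.momentAngle => s p.1.1 := hs.comp (by fun_prop)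
        have h_coords := (continuous_extendCoords e).comp
          (h_base.prodMk (continuous_snd.comp continuous_subtype_val))
        exact (h_base.prodMk h_coords).subtype_mk _ }
  r := TopCat.ofHom
    { toFun p := ⟨(π p.1.1, p.1.2 ∘ e), fun i => (p.2.1 (e i)).trans_eq (h_ell i _),
        fun i => (p.2.2 (e i)).trans (h_ell i _)⟩
      continuous_toFun := by
        have h_base : Continuous fun p : Q.momentAngle => π p.1.1 := hπ.comp (by fun_prop)
        have h_coords : Continuous fun p : Q.momentAngle => p.1.2 ∘ e :=
          continuous_pi fun i => by
            simp only [Function.comp_apply]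
            fun_prop
        exact (h_base.prodMk h_coords).subtype_mk _ }
  retract := by
    ext p
    exact Subtype.ext (Prod.ext (h_section _) (funext (extendCoords_apply e _)))

end Retract

section FaceCut

variable {Q : HPolytope (n + 1)}

lemma IsFaceCut.isSimple (h : P.IsFaceCut Q) (hP : P.IsSimple) : Q.IsSimple := by
  obtain ⟨i, c, d, h_cut, rfl⟩ := h
  refine h_cut.isSimple_cut hP.prodInterval (Set.nontrivial_pair (sideFacet_ne_topFacet i)) ?_
  obtain ⟨x, hx⟩ := hP.face_singleton_nonempty i
  refine ⟨Fin.snoc x 1, mem_prodInterval_face.2 ?_⟩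
  rw [Fin.init_snoc, Fin.snoc_last]
  refine ⟨face_subset_face (fun j hj => ?_) hx, by simp, ?_, fun _ => rfl⟩
  · exact sideFacet.injective (hj.resolve_right (sideFacet_ne_topFacet j))
  · rintro (h | h)
    · exact absurd h.symm (sideFacet_ne_bottomFacet i)
    · exact absurd h bottomFacet_ne_topFacet

lemma IsFaceCut.isFlag (h : P.IsFaceCut Q) (hP : P.IsSimple) (hF : P.IsFlag) : Q.IsFlag := by
  obtain ⟨i, c, d, h_cut, rfl⟩ := h
  exact h_cut.isFlag_cut hP.prodInterval hF.prodInterval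

lemma CutsOff.pos_of_last_eq_zero {S : Set P.prodInterval.ι} {c : Fin (n + 1) → ℝ} {d : ℝ}
    (h : P.prodInterval.CutsOff S c d) (hP : Bornology.IsBounded P.carrier) (hS : topFacet ∈ S)
    {y : Fin (n + 1) → ℝ} (hy : y ∈ P.prodInterval.carrier) (hy_zero : y (Fin.last n) = 0) :
    0 < c ⬝ᵥ y + d := by
  have hy_bot : y ∈ P.prodInterval.face {bottomFacet} :=
    ⟨hy, by rintro _ rfl; rwa [prodInterval_ell_bottomFacet]⟩
  by_contra! h_nonpos
  obtain ⟨x, hx⟩ := h.face_union_nonempty (isBounded_prodInterval hP) hy_bot h_nonpos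
  obtain ⟨-, -, h0, h1⟩ := mem_prodInterval_face.1 hx
  exact zero_ne_one ((h0 (Or.inr rfl)).symm.trans (h1 (Or.inl hS)))

lemma IsFaceCut.nonempty_retract (h : P.IsFaceCut Q) (hP : Bornology.IsBounded P.carrier) :
    Nonempty (Retract P.Z Q.Z) := by
  obtain ⟨i, c, d, h_cut, rfl⟩ := h
  have h_snoc : Continuous fun x : Fin n → ℝ => (Fin.snoc x 0 : Fin (n + 1) → ℝ) :=
    Continuous.finSnoc (A := fun _ => ℝ) continuous_id continuous_const
  refine ⟨momentAngleRetract (sideFacet.trans oldFacet) (Continuous.finInit continuous_id) h_snoc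
    (fun x => Fin.init_snoc _ _) (fun j y => prodInterval_ell_sideFacet j y) fun x hx => ?_⟩
  have h_mem : Fin.snoc x 0 ∈ P.prodInterval.carrier := mem_prodInterval_carrier.2 (by simpa)
  exact mem_cut_carrier.2
    ⟨h_mem, (h_cut.pos_of_last_eq_zero hP (Or.inr rfl) h_mem (Fin.snoc_last _ _)).le⟩

lemma exists_isFaceCut (P : HPolytope n) [Nonempty P.ι] : ∃ Q, P.IsFaceCut Q :=
  let ⟨i⟩ := ‹Nonempty P.ι›
  let ⟨c, d, h⟩ := P.prodInterval.exists_cutsOff {sideFacet i, topFacet}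
  ⟨_, i, c, d, h, rfl⟩

end FaceCut

end HPolytope

lemma exists_seq_forall_ge_rel_succ {α : ℕ → Type*} [∀ n, Nonempty (α n)]
    {rel : ∀ n, α n → α (n + 1) → Prop} (h : ∀ n x, ∃ y, rel n x y) {r : ℕ} (x : α r) :
    ∃ f : ∀ n, α n, f r = x ∧ ∀ n, r ≤ n → rel n (f n) (f (n + 1)) := by
  choose next h_next using h
  let g (n : ℕ) (hn : r ≤ n) : α n := Nat.leRec x (fun k _ => next k) hn
  refine ⟨fun n => if hn : r ≤ n then g n hn else Classical.arbitrary _, ?_, fun n hn => ?_⟩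
  · beta_reduce
    rw [dif_pos le_rfl]
    exact Nat.leRec_self _ _
  · have h_succ : g (n + 1) (hn.trans n.le_succ) = next n (g n hn) := Nat.leRec_succ _ _ hn
    beta_reduce
    rw [dif_pos hn, dif_pos (hn.trans n.le_succ), h_succ]
    exact h_next n _

namespace HPolytope

section FaceCutSequence

variable {r : ℕ} {F : HPolytope r}

lemma exists_isFaceCutSequence (F : HPolytope r) [Nonempty F.ι] :
    ∃ P : ∀ n, HPolytope n, IsFaceCutSequence F P := by
  have (n : ℕ) : Nonempty {P : HPolytope n // Nonempty P.ι} :=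
    ⟨⟨⟨Unit, inferInstance, 0, 0⟩, inferInstance⟩⟩
  obtain ⟨P, hP, h_cut⟩ := exists_seq_forall_ge_rel_succ
    (α := fun n => {P : HPolytope n // Nonempty P.ι}) (rel := fun n P Q => P.1.IsFaceCut Q.1)
    (fun n ⟨P, _⟩ => by
      obtain ⟨Q, hQ⟩ := P.exists_isFaceCut
      have : Nonempty Q.ι := by
        obtain ⟨i, c, d, -, rfl⟩ := hQ
        exact ⟨newFacet⟩
      exact ⟨⟨Q, this⟩, hQ⟩) ⟨F, inferInstance⟩
  exact ⟨fun n => P n, congrArg Subtype.val hP, h_cut⟩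

variable {P : ∀ n, HPolytope n} {n : ℕ}

lemma IsFaceCutSequence.isSimple (h : IsFaceCutSequence F P) (hF : F.IsSimple) (hn : r ≤ n) :
    (P n).IsSimple :=
  Nat.le_induction (P := fun n _ => (P n).IsSimple) (h.1 ▸ hF)
    (fun n hn ih => (h.2 n hn).isSimple ih) n hn

lemma IsFaceCutSequence.isFlag (h : IsFaceCutSequence F P) (hF : F.IsSimple)
    (hFlag : F.IsFlag) (hn : r ≤ n) : (P n).IsFlag :=
  Nat.le_induction (P := fun n _ => (P n).IsFlag) (h.1 ▸ hFlag)
    (fun n hn ih => (h.2 n hn).isFlag (h.isSimple hF hn) ih) n hn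

lemma IsFaceCutSequence.hasNontrivialMasseyProduct {R : Type*} [CommRing R] {k : ℕ}
    {deg : Fin k → ℕ} (h : IsFaceCutSequence F P) (hF : F.IsSimple)
    (hM : HasNontrivialMasseyProduct R F.Z deg) (hn : r ≤ n) :
    HasNontrivialMasseyProduct R (P n).Z deg :=
  Nat.le_induction (P := fun n _ => HasNontrivialMasseyProduct R (P n).Z deg) (h.1 ▸ hM)
    (fun n hn ih =>
      let ⟨ρ⟩ := (h.2 n hn).nonempty_retract (h.isSimple hF hn).bounded
      ih.of_retract ρ) n hn

end FaceCutSequence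

end HPolytope

end

theorem corollary4p2 (R : Type*) [CommRing R] {r : ℕ} (hr : 0 < r) (F : HPolytope r)
    (hF : F.IsSimple) (hFlag : F.IsFlag) {k : ℕ} (hk : 2 ≤ k) (deg : Fin k → ℕ)
    (hM : HasNontrivialMasseyProduct R F.Z deg) :
    (∃ P : ∀ n, HPolytope n, HPolytope.IsFaceCutSequence F P) ∧
    ∀ P : ∀ n, HPolytope n, HPolytope.IsFaceCutSequence F P →
      ∀ n, r ≤ n → (P n).IsSimple ∧ (P n).IsFlag ∧ HasNontrivialMasseyProduct R (P n).Z deg := by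
  have : Nonempty F.ι := hF.nonempty_index hr
  exact ⟨HPolytope.exists_isFaceCutSequence F, fun P hP n hn =>
    ⟨hP.isSimple hF hn, hP.isFlag hF hFlag hn, hP.hasNontrivialMasseyProduct hF hM hn⟩⟩
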